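/- Let $n\ge 0$, $d\ge 1$, let $J=\begin{pmatrix}0&I\\-I&0\end{pmatrix}$, and let $D(\xi)=\exp(-i\sqrt{2\pi}\,\xi^TJ\hat x)$, $\xi\in\mathbb R^{2n}$, be the displacement operators on $L^2(\mathbb R^n)$. Let $\mathcal L=\sqrt d\,\mathcal L_0$ be the lattice of a scaled GKP code, where $\mathcal L_0\subset\mathbb R^{2n}$ is a full-rank lattice that equals its symplectic dual, and let $\mathcal L^\perp=\{x: x^TJ\xi\in\mathbb Z\ \forall \xi\in\mathcal L\}$; the code has logical dimension $d^n$. For $S\in\mathrm{Aut}^S(\mathcal L^\perp)$ (symplectic automorphisms of $\mathcal L^\perp$) let $U_S$ be a Gaussian unitary with $D(S\xi)U_S=U_SD(\xi)$ for all $\xi$. Let $\mu$ be a probability distribution on Gaussian unitaries $U=D(\xi)U_S$, $\xi\in\mathcal L^\perp$, $S\in\mathrm{Aut}^S(\mathcal L^\perp)$, whose logical actions form a logical Clifford 2-design: the twirl over $\mu$ of every linear map on logical operators has the form $X\mapsto aX+b\,\mathrm{Tr}(X)I$. Let $\mathrm{Dec}$ be a decoder: a linear, trace-norm continuous map from trace-class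 operators on $L^2(\mathbb R^n)$ to $d^n\times d^n$ matrices that maps the states onto the logical states, intertwines the displacements $D(\xi)$, $\xi\in\mathcal L^\perp$, with the logical Pauli operators and the Gaussian unitaries in the support of $\mu$ with their logical Clifford gates, and satisfies $\mathrm{Dec}(D(x)\rho_kD(x)^\dagger)-\mathrm{Dec}(\rho_k)\to0$ for every $x$ in the interior of the Voronoi cell of $\mathcal L^\perp$ and all states $\rho_k$ whose stabilizer-generator expectation values tend to $1$. Let $\int dz\,\Pi(z)=I$ be a POVM resolved by (measurable) density operators $\Pi(z)$ with respect to a $\sigma$-finite measure $dz$, and put $\mathcal M(\sigma)=\int dz\,\mathrm{Tr}[\Pi(z)\sigma]\,\Pi(z)$ and $\mathcal M^\tau(\sigma)=\int d\mu(U)\,U\mathcal M(U^\dagger\sigma U)U^\dagger$. Suppose that for real numbers $\alpha\neq0$ and $\beta$ $$\mathrm{Dec}(\mathcal M^\tau(\sigma))=\alpha\,\mathrm{Dec}(\sigma)+\beta\,\Pi_{\mathcal L}\qquad\text{for all states }\sigma,$$ where $\Pi_{\mathcal L}$ is the identity on the logical space, and write $\widetilde M^{-1}(X)=(X-\beta\,\Pi_{\mathcal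 L})/\alpha$. Let $\rho$ be any state on $L^2(\mathbb R^n)$, let $\delta,\delta_{HS}>0$, let $(U_i,z_i)$, $i=1,\dots,N$, be independent, with $U_i\sim\mu$ and $z_i$ given $U_i$ distributed as $\mathrm{Tr}[\Pi(z)U_i^\dagger\rho U_i]\,dz$, and let $S=\frac1N\sum_{i=1}^N U_i\Pi(z_i)U_i^\dagger$. If $$N\ \ge\ \frac{2d^{2n}}{\alpha^2\delta_{HS}^2}\Big[\ln\frac2\delta+2n\ln d\Big],$$ then with probability at least $1-\delta$ both $$\mathrm{Tr}\big[(\mathrm{Dec}(\rho)-\widetilde M^{-1}(\mathrm{Dec}(S)))^2\big]\le\delta_{HS}^2\quad\text{and}\quad \tfrac12\big\|\mathrm{Dec}(\rho)-\widetilde M^{-1}(\mathrm{Dec}(S))\big\|_1\le d^{n/2}\,\frac{\delta_{HS}}2 .$$ -/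

import Mathlib

open MeasureTheory ProbabilityTheory Filter Topology
open scoped ENNReal Matrix InnerProductSpace ComplexOrder

noncomputable section

namespace GKP

/-! ### Phase space, Hilbert space and displacement operators -/

/-- Phase space `ℝ^{2n}` with its Euclidean norm; `Sum.inl i` is the position coordinate of mode `i`
and `Sum.inr i` its momentum coordinate. -/
abbrev PhaseSpace (n : ℕ) : Type := EuclideanSpace ℝ (Fin n ⊕ Fin n)

/-- Position part of a phase space point. -/
def posPart {n : ℕ} (ξ : PhaseSpace n) : EuclideanSpace ℝ (Fin n) :=
  WithLp.toLp 2 fun i => ξ (Sum.inl i)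

/-- Momentum part of a phase space point. -/
def momPart {n : ℕ} (ξ : PhaseSpace n) : EuclideanSpace ℝ (Fin n) :=
  WithLp.toLp 2 fun i => ξ (Sum.inr i)

/-- The symplectic form `ξᵀ J η` with `J = [[0, I], [-I, 0]]`. -/
def sympForm {n : ℕ} (ξ η : PhaseSpace n) : ℝ :=
  ∑ i : Fin n, (ξ (Sum.inl i) * η (Sum.inr i) - ξ (Sum.inr i) * η (Sum.inl i))

/-- The Hilbert space `L²(ℝⁿ)` of `n` modes (position representation). -/
abbrev ModeSpace (n : ℕ) : Type :=
  Lp ℂ 2 (volume : Measure (EuclideanSpace ℝ (Fin n)))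

/-- Bounded operators on the `n`-mode Hilbert space. -/
abbrev ModeOp (n : ℕ) : Type := ModeSpace n →L[ℂ] ModeSpace n

/-- Unitary operators on the `n`-mode Hilbert space. -/
abbrev ModeUnitary (n : ℕ) : Type := ModeSpace n ≃ₗᵢ[ℂ] ModeSpace n

/-- The phase function `x ↦ e^{i(c + ⟨b, x⟩)}`. -/
def phaseFun {n : ℕ} (c : ℝ) (b : EuclideanSpace ℝ (Fin n)) (x : EuclideanSpace ℝ (Fin n)) : ℂ :=
  Complex.exp (((c + ⟪b, x⟫_ℝ : ℝ) : ℂ) * Complex.I)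

theorem norm_phaseFun {n : ℕ} (c : ℝ) (b x : EuclideanSpace ℝ (Fin n)) :
    ‖phaseFun c b x‖ = 1 := Complex.norm_exp_ofReal_mul_I _

theorem continuous_phaseFun {n : ℕ} (c : ℝ) (b : EuclideanSpace ℝ (Fin n)) :
    Continuous (phaseFun c b) := by
  unfold phaseFun
  fun_prop

theorem phaseFun_mul_neg {n : ℕ} (c : ℝ) (b x : EuclideanSpace ℝ (Fin n)) :
    phaseFun c b x * phaseFun (-c) (-b) x = 1 := by
  unfold phaseFun
  rw [← Complex.exp_add, Complex.exp_eq_one_iff]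
  refine ⟨0, ?_⟩
  rw [inner_neg_left]
  push_cast
  ring

theorem memLp_phase {n : ℕ} (c : ℝ) (b : EuclideanSpace ℝ (Fin n)) (ψ : ModeSpace n) :
    MemLp (fun x => phaseFun c b x * ψ x) 2 (volume : Measure (EuclideanSpace ℝ (Fin n))) := by
  refine (Lp.memLp ψ).congr_norm
    (((continuous_phaseFun c b).aestronglyMeasurable).mul (Lp.aestronglyMeasurable ψ)) ?_
  filter_upwards with x
  rw [norm_mul, norm_phaseFun, one_mul]

/-- Multiplication by the phase `e^{i(c + ⟨b, x⟩)}` as a linear isometry of `L²(ℝⁿ)`. -/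
def phaseIsometry {n : ℕ} (c : ℝ) (b : EuclideanSpace ℝ (Fin n)) :
    ModeSpace n →ₗᵢ[ℂ] ModeSpace n where
  toFun ψ := (memLp_phase c b ψ).toLp _
  map_add' ψ φ := by
    apply Lp.ext
    filter_upwards [(memLp_phase c b (ψ + φ)).coeFn_toLp, (memLp_phase c b ψ).coeFn_toLp,
      (memLp_phase c b φ).coeFn_toLp, Lp.coeFn_add ψ φ,
      Lp.coeFn_add ((memLp_phase c b ψ).toLp _) ((memLp_phase c b φ).toLp _)] with x h1 h2 h3 h4 h5
    rw [h1, h5, Pi.add_apply, h2, h3, h4, Pi.add_apply, mul_add]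
  map_smul' a ψ := by
    apply Lp.ext
    filter_upwards [(memLp_phase c b (a • ψ)).coeFn_toLp, (memLp_phase c b ψ).coeFn_toLp,
      Lp.coeFn_smul a ψ, Lp.coeFn_smul a ((memLp_phase c b ψ).toLp _)] with x h1 h2 h3 h4
    simp only [RingHom.id_apply]
    rw [h1, h4, Pi.smul_apply, h2, h3, Pi.smul_apply, smul_eq_mul, smul_eq_mul]
    ring
  norm_map' ψ := by
    change ‖(memLp_phase c b ψ).toLp _‖ = ‖ψ‖
    refine le_antisymm (Lp.norm_le_norm_of_ae_le ?_) (Lp.norm_le_norm_of_ae_le ?_)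
    all_goals
      filter_upwards [(memLp_phase c b ψ).coeFn_toLp] with x h1
      rw [h1, norm_mul, norm_phaseFun, one_mul]

theorem coeFn_phaseIsometry {n : ℕ} (c : ℝ) (b : EuclideanSpace ℝ (Fin n)) (ψ : ModeSpace n) :
    phaseIsometry c b ψ =ᵐ[volume] fun x => phaseFun c b x * ψ x :=
  (memLp_phase c b ψ).coeFn_toLp

theorem phaseIsometry_surjective {n : ℕ} (c : ℝ) (b : EuclideanSpace ℝ (Fin n)) :
    Function.Surjective (phaseIsometry c b) := by
  intro ψ
  refine ⟨phaseIsometry (-c) (-b) ψ, ?_⟩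
  apply Lp.ext
  filter_upwards [coeFn_phaseIsometry c b (phaseIsometry (-c) (-b) ψ),
    coeFn_phaseIsometry (-c) (-b) ψ] with x h1 h2
  rw [h1, h2, ← mul_assoc, phaseFun_mul_neg, one_mul]

/-- Multiplication by the phase `e^{i(c + ⟨b, x⟩)}` as a unitary operator. -/
def phaseUnitary {n : ℕ} (c : ℝ) (b : EuclideanSpace ℝ (Fin n)) : ModeUnitary n :=
  LinearIsometryEquiv.ofSurjective (phaseIsometry c b) (phaseIsometry_surjective c b)

/-- The translation `ψ ↦ ψ(· - a)` as a linear isometry. -/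
def shiftIsometry {n : ℕ} (a : EuclideanSpace ℝ (Fin n)) : ModeSpace n →ₗᵢ[ℂ] ModeSpace n :=
  Lp.compMeasurePreservingₗᵢ ℂ (fun x => x - a) (measurePreserving_sub_right volume a)

theorem coeFn_shiftIsometry {n : ℕ} (a : EuclideanSpace ℝ (Fin n)) (ψ : ModeSpace n) :
    shiftIsometry a ψ =ᵐ[volume] fun x => ψ (x - a) :=
  Lp.coeFn_compMeasurePreserving ψ (measurePreserving_sub_right volume a)

theorem shiftIsometry_surjective {n : ℕ} (a : EuclideanSpace ℝ (Fin n)) :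
    Function.Surjective (shiftIsometry a) := by
  intro ψ
  refine ⟨shiftIsometry (-a) ψ, ?_⟩
  apply Lp.ext
  have h := (measurePreserving_sub_right (volume : Measure (EuclideanSpace ℝ (Fin n)))
    a).quasiMeasurePreserving.ae_eq_comp (coeFn_shiftIsometry (-a) ψ)
  filter_upwards [coeFn_shiftIsometry a (shiftIsometry (-a) ψ), h] with x h1 h2
  rw [h1]
  simpa using h2

/-- The translation `ψ ↦ ψ(· - a)` as a unitary operator. -/
def shiftUnitary {n : ℕ} (a : EuclideanSpace ℝ (Fin n)) : ModeUnitary n :=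
  LinearIsometryEquiv.ofSurjective (shiftIsometry a) (shiftIsometry_surjective a)

/-- The displacement operator `D(ξ) = exp(-i √(2π) ξᵀ J x̂)`, `x̂ = (q̂, p̂)`. For `ξ = (a, b)` it acts
as `(D(ξ) ψ)(x) = e^{-iπ ⟨a, b⟩} e^{i √(2π) ⟨b, x⟩} ψ(x - √(2π) a)`. -/
def displacement {n : ℕ} (ξ : PhaseSpace n) : ModeUnitary n :=
  (shiftUnitary (Real.sqrt (2 * Real.pi) • posPart ξ)).trans
    (phaseUnitary (-(Real.pi * ⟪posPart ξ, momPart ξ⟫_ℝ)) (Real.sqrt (2 * Real.pi) • momPart ξ))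

/-- The unitary channel `T ↦ U T U†`. -/
def conj {n : ℕ} (U : ModeUnitary n) (T : ModeOp n) : ModeOp n :=
  (U : ModeSpace n →L[ℂ] ModeSpace n) ∘L T ∘L (U.symm : ModeSpace n →L[ℂ] ModeSpace n)

/-! ### Trace and density operators -/

/-- A Hilbert basis of the `n`-mode space. The trace below does not depend on the choice. -/
def modeBasis (n : ℕ) : HilbertBasis (exists_hilbertBasis ℂ (ModeSpace n)).choose ℂ (ModeSpace n) :=
  (exists_hilbertBasis ℂ (ModeSpace n)).choose_spec.choose

/-- The trace `∑ᵢ ⟨eᵢ, T eᵢ⟩`; it is only applied to trace class operators. -/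
def opTrace {n : ℕ} (T : ModeOp n) : ℂ :=
  ∑' i, ⟪modeBasis n i, T (modeBasis n i)⟫_ℂ

/-- Density operators (states): positive operators of trace one. -/
def IsDensityOp {n : ℕ} (T : ModeOp n) : Prop :=
  T.IsPositive ∧ HasSum (fun i => ⟪modeBasis n i, T (modeBasis n i)⟫_ℂ) 1

/-! ### Scaled GKP codes -/

/-- The symplectic dual `Λ^⊥ = {x | xᵀ J ξ ∈ ℤ for all ξ ∈ Λ}`. -/
def symplDual {n : ℕ} (Λ : Set (PhaseSpace n)) : Set (PhaseSpace n) :=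
  {x | ∀ ξ ∈ Λ, ∃ m : ℤ, sympForm x ξ = m}

/-- The set of all integer combinations of a family of vectors. -/
def latticeOf {n : ℕ} (b : Fin n ⊕ Fin n → PhaseSpace n) : Set (PhaseSpace n) :=
  (AddSubgroup.closure (Set.range b) : AddSubgroup (PhaseSpace n))

/-- A scaled GKP code with local dimension `d` on `n` modes: a basis of a symplectically self-dual
full rank lattice `ℒ₀ = ℒ₀^⊥`. The code lattice is `ℒ = √d ℒ₀`. -/
structure ScaledCode (n d : ℕ) where
  /-- the basis of the self-dual lattice `ℒ₀` -/
  basis : Module.Basis (Fin n ⊕ Fin n) ℝ (PhaseSpace n)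
  self_dual : symplDual (latticeOf basis) = latticeOf basis

namespace ScaledCode

variable {n d : ℕ}

/-- The stabilizer generators `ξ_i = √d b_i`, whose displacements are fixed to `+1`. -/
def generator (C : ScaledCode n d) (i : Fin n ⊕ Fin n) : PhaseSpace n :=
  Real.sqrt d • C.basis i

/-- The code lattice `ℒ = √d ℒ₀`. -/
def lattice (C : ScaledCode n d) : Set (PhaseSpace n) := latticeOf C.generator

/-- The dual lattice `ℒ^⊥` of logical displacements. -/
def dual (C : ScaledCode n d) : Set (PhaseSpace n) := symplDual C.lattice

end ScaledCode

/-- Symplectic automorphisms of the dual lattice, `Aut^S(ℒ^⊥)`. -/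
structure SymplAut {n d : ℕ} (C : ScaledCode n d) where
  /-- the linear map on phase space -/
  toEquiv : PhaseSpace n ≃ₗ[ℝ] PhaseSpace n
  symplectic : ∀ ξ η, sympForm (toEquiv ξ) (toEquiv η) = sympForm ξ η
  image_dual : toEquiv '' C.dual = C.dual

/-- `U` is a Gaussian unitary `U_S` that represents the symplectic map `S`:
`D(S ξ) U = U D(ξ)` for all `ξ`. (This determines `U` up to a phase.) -/
def IsGaussianUnitary {n : ℕ} (S : PhaseSpace n ≃ₗ[ℝ] PhaseSpace n) (U : ModeUnitary n) : Prop :=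
  ∀ (ξ : PhaseSpace n) (ψ : ModeSpace n),
    displacement (S ξ) (U ψ) = U (displacement ξ ψ)

/-- Labels of the Gaussian unitaries `D(ξ) U_S` with `ξ ∈ ℒ^⊥` and `S ∈ Aut^S(ℒ^⊥)`; the pure `U_S` are
those with `ξ = 0`. -/
structure Gate {n d : ℕ} (C : ScaledCode n d) where
  /-- the logical displacement amplitude -/
  disp : C.dual
  /-- the symplectic automorphism -/
  aut : SymplAut C

/-- The (countable) set of gate labels is a discrete measurable space. -/
instance instMeasurableSpaceGate {n d : ℕ} (C : ScaledCode n d) : MeasurableSpace (Gate C) := ⊤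

/-- The physical unitary `D(ξ) U_S` of a gate, for a choice `S ↦ U_S` of Gaussian unitaries. -/
def gateUnitary {n d : ℕ} {C : ScaledCode n d} (U : SymplAut C → ModeUnitary n) (g : Gate C) :
    ModeUnitary n :=
  (U g.aut).trans (displacement (g.disp : PhaseSpace n))

/-! ### The logical level -/

/-- Index set of the computational basis of `n` qudits of dimension `d`. -/
abbrev LogIdx (n d : ℕ) : Type := Fin n → Fin d

/-- Operators on the logical space `ℂ^{d^n}`. -/
abbrev LogOp (n d : ℕ) : Type := Matrix (LogIdx n d) (LogIdx n d) ℂ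

/-- Unitaries on the logical space. -/
abbrev LogUnitary (n d : ℕ) : Type := Matrix.unitaryGroup (LogIdx n d) ℂ

/-- The logical unitary channel `X ↦ W X W†`. -/
def logConj {n d : ℕ} (W : LogUnitary n d) (X : LogOp n d) : LogOp n d :=
  (W : LogOp n d) * X * (W : LogOp n d)ᴴ

/-- Logical density matrices. -/
def IsDensityMatrix {n d : ℕ} (X : LogOp n d) : Prop := X.PosSemidef ∧ X.trace = 1

/-- `P ξ` (`ξ ∈ ℒ^⊥`) is the logical Pauli operator by which `D(ξ)` acts on the code space: the Weyl
relations hold, and the stabilizer generators act trivially. -/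
structure IsLogicalPauli {n d : ℕ} (C : ScaledCode n d) (P : PhaseSpace n → LogUnitary n d) :
    Prop where
  weyl : ∀ ξ ∈ C.dual, ∀ η ∈ C.dual, (P ξ * P η : LogOp n d) =
    Complex.exp (-(Complex.I * Real.pi * (sympForm ξ η : ℂ))) • (P (ξ + η) : LogOp n d)
  stabilizer : ∀ i, (P (C.generator i) : LogOp n d) = 1

/-- `V S` is a logical Clifford unitary with symplectic action `S`: it maps the Pauli operator of `ξ`
to that of `S ξ`, up to a phase. -/
def IsLogicalClifford {n d : ℕ} {C : ScaledCode n d} (P : PhaseSpace n → LogUnitary n d)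
    (V : SymplAut C → LogUnitary n d) : Prop :=
  ∀ S : SymplAut C, ∀ ξ ∈ C.dual, ∃ c : ℂ, ‖c‖ = 1 ∧
    logConj (V S) (P ξ : LogOp n d) = c • (P (S.toEquiv ξ) : LogOp n d)

/-- The logical Clifford gate `P(ξ) V(S)` of the physical gate `D(ξ) U_S`. -/
def gateLogical {n d : ℕ} {C : ScaledCode n d} (P : PhaseSpace n → LogUnitary n d)
    (V : SymplAut C → LogUnitary n d) (g : Gate C) : LogUnitary n d :=
  P g.disp * V g.aut

/-- The gates drawn from `μ` form a logical (Clifford) 2-design: the twirl of every linear map on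
logical operators is a combination of the identity and the fully depolarizing map. -/
def IsTwoDesign {n d : ℕ} {C : ScaledCode n d} (P : PhaseSpace n → LogUnitary n d)
    (V : SymplAut C → LogUnitary n d) (μ : PMF (Gate C)) : Prop :=
  ∀ Φ : LogOp n d →ₗ[ℂ] LogOp n d, ∃ a b : ℂ, ∀ X : LogOp n d,
    ∑' g, ((μ g).toReal : ℂ) •
        logConj (gateLogical P V g) (Φ (logConj (gateLogical P V g)⁻¹ X)) =
      a • X + (b * X.trace) • (1 : LogOp n d)

/-! ### Decoders -/

/-- The linear map from trace class operators to logical operators with entries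
`Dec(T)_{jk} = Tr(E_{jk} T)`, for bounded operators `E_{jk}`. Every trace norm continuous linear map (in
particular every positive one) into matrices is of this form, by the duality of trace class and
bounded operators. -/
def decode {n d : ℕ} (E : LogIdx n d → LogIdx n d → ModeOp n) (T : ModeOp n) : LogOp n d :=
  Matrix.of fun j k => opTrace (E j k ∘L T)

/-- The interior of the Voronoi cell of `ℒ^⊥`. -/
def voronoiInterior {n d : ℕ} (C : ScaledCode n d) : Set (PhaseSpace n) :=
  {x | ∀ ξ ∈ C.dual, ξ ≠ 0 → ‖x‖ < ‖x - ξ‖}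

/-- A sequence of states that approaches the (not normalizable) ideal code states: the expectation
values of all stabilizer generators tend to one. -/
def TendsToCode {n d : ℕ} (C : ScaledCode n d) (ρ : ℕ → ModeOp n) : Prop :=
  (∀ k, IsDensityOp (ρ k)) ∧ ∀ i, Tendsto
    (fun k => opTrace ((displacement (C.generator i) : ModeSpace n →L[ℂ] ModeSpace n) ∘L ρ k))
    atTop (𝓝 1)

/-- Decoders of a GKP code, relative to a set `G` of Gaussian unitaries that are used as logical
Clifford gates. -/
structure IsDecoder {n d : ℕ} (C : ScaledCode n d) (P : PhaseSpace n → LogUnitary n d)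
    (U : SymplAut C → ModeUnitary n) (V : SymplAut C → LogUnitary n d) (G : Set (Gate C))
    (E : LogIdx n d → LogIdx n d → ModeOp n) : Prop where
  /-- states are mapped to logical states -/
  map_state : ∀ ρ, IsDensityOp ρ → IsDensityMatrix (decode E ρ)
  /-- every logical state is attained -/
  surjective : ∀ X : LogOp n d, IsDensityMatrix X → ∃ ρ, IsDensityOp ρ ∧ decode E ρ = X
  /-- compatibility with logical Pauli gates -/
  comm_pauli : ∀ ξ ∈ C.dual, ∀ ρ, IsDensityOp ρ →
    decode E (conj (displacement ξ) ρ) = logConj (P ξ) (decode E ρ)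
  /-- compatibility with the logical Clifford gates in `G` -/
  comm_clifford : ∀ g ∈ G, ∀ ρ, IsDensityOp ρ →
    decode E (conj (gateUnitary U g) ρ) = logConj (gateLogical P V g) (decode E ρ)
  /-- displacements from the Voronoi cell act as the logical identity on code states -/
  correct : ∀ x ∈ voronoiInterior C, ∀ ρ : ℕ → ModeOp n, TendsToCode C ρ →
    Tendsto (fun k => decode E (conj (displacement x) (ρ k)) - decode E (ρ k)) atTop (𝓝 0)

/-! ### POVMs, twirling and sampling -/

/-- A POVM `∫ Π(z) dz = I`, resolved by density operators `Π(z)` (the pointer states). -/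
structure IsPOVM {n : ℕ} {Z : Type*} [MeasurableSpace Z] (ν : Measure Z) (Pi : Z → ModeOp n) :
    Prop where
  measurable : StronglyMeasurable Pi
  density : ∀ z, IsDensityOp (Pi z)
  resolution : ∀ ψ : ModeSpace n, ∫ z, ⟪ψ, Pi z ψ⟫_ℂ ∂ν = ((‖ψ‖ ^ 2 : ℝ) : ℂ)

/-- The measure-and-prepare channel `ℳ(σ) = ∫ dz Tr(Π(z) σ) Π(z)`. -/
def povmChannel {n : ℕ} {Z : Type*} [MeasurableSpace Z] (ν : Measure Z) (Pi : Z → ModeOp n)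
    (σ : ModeOp n) : ModeOp n :=
  ∫ z, opTrace (Pi z ∘L σ) • Pi z ∂ν

/-- The twirl `Φ^τ(σ) = ∫ dμ(g) U_g Φ(U_g† σ U_g) U_g†`. -/
def twirl {n d : ℕ} {C : ScaledCode n d} (μ : PMF (Gate C)) (U : SymplAut C → ModeUnitary n)
    (Φ : ModeOp n → ModeOp n) (σ : ModeOp n) : ModeOp n :=
  ∑' g, ((μ g).toReal : ℂ) • conj (gateUnitary U g) (Φ (conj (gateUnitary U g).symm σ))

/-- The joint law of a sample `(g, z)`: `g` is drawn from `μ`, and then `z` from the Born distribution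
`Tr(Π(z) U_g† ρ U_g) dz`. -/
def sampleLaw {n d : ℕ} {C : ScaledCode n d} {Z : Type*} [MeasurableSpace Z] (ν : Measure Z)
    (Pi : Z → ModeOp n) (μ : PMF (Gate C)) (U : SymplAut C → ModeUnitary n) (ρ : ModeOp n) :
    Measure (Gate C × Z) :=
  (μ.toMeasure.prod ν).withDensity fun x =>
    ENNReal.ofReal (opTrace (Pi x.2 ∘L conj (gateUnitary U x.1).symm ρ)).re

/-- The empirical shadow `S = N⁻¹ ∑ᵢ U_{gᵢ} Π(zᵢ) U_{gᵢ}†`. -/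
def shadow {n d : ℕ} {C : ScaledCode n d} {Z : Type*} (Pi : Z → ModeOp n)
    (U : SymplAut C → ModeUnitary n) {N : ℕ} (s : Fin N → Gate C × Z) : ModeOp n :=
  (N : ℂ)⁻¹ • ∑ i, conj (gateUnitary U (s i).1) (Pi (s i).2)

/-! ### Distances and the inverse of the logical depolarizing channel -/

/-- The inverse `X ↦ (X - β Π_ℒ) / α` of the logical depolarizing channel on matrices of trace one. -/
def depolInv {n d : ℕ} (α β : ℝ) (X : LogOp n d) : LogOp n d :=
  (α : ℂ)⁻¹ • (X - (β : ℂ) • (1 : LogOp n d))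

/-- The Hilbert-Schmidt distance `Tr((X - Y)† (X - Y))`. -/
def dHS {n d : ℕ} (X Y : LogOp n d) : ℝ := (((X - Y)ᴴ * (X - Y)).trace).re

/-- The trace norm: the sum of the singular values. -/
def traceNorm {n d : ℕ} (X : LogOp n d) : ℝ :=
  ∑ i, Real.sqrt ((Matrix.isHermitian_conjTranspose_mul_self X).eigenvalues i)

/-- The trace distance `½ ‖X - Y‖₁`. -/
def traceDist {n d : ℕ} (X Y : LogOp n d) : ℝ := (1 / 2) * traceNorm (X - Y)

end GKP

end

/-! Each snapshot `decode E (conj (gateUnitary U g) (Pi z))` is a logical density matrix, since the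
pointer states, their unitary conjugates and their decodings are states. Its mean under the sample
law is the decoding of the twirled channel at ρ, hence α Dec(ρ) + β 1 by hypothesis. The theorem is
therefore a concentration bound for an empirical mean of independent random density matrices of size
D = d^n.

A Hermitian D × D matrix has D² real coordinates Re + Im of its entries, orthonormal for the
Hilbert-Schmidt inner product (`trace_conjTranspose_mul_self_re_eq_sum_sq`) and bounded by 1 on
density matrices (`abs_reAddIm_le_one`). Hoeffding with deviation ε = |α| δHS / D and a union bound
give failure probability at most 2 D² exp(-N ε²/2), which the sample size brings below δ. Otherwise
the squared Hilbert-Schmidt error of the mean is at most D² ε² = α² δHS², and inverting the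
depolarizing map divides it by α². Cauchy-Schwarz over D singular values gives the trace distance.

The analytic work is the formula for the mean. The integrals are Bochner integrals in operator norm,
for which the trace is not continuous. Factoring a state as S² with S of Hilbert-Schmidt norm 1
bounds the diagonal series of E T absolutely, uniformly over states T, so that sum and integral can
be exchanged (`opTrace_comp_integral`). -/

namespace GKP

/-! ### Hilbert-Schmidt operators and cyclicity of the trace -/

section HilbertSchmidt

variable {ι H : Type*} [NormedAddCommGroup H] [InnerProductSpace ℂ H]

theorem exists_symmetric_sq [CompleteSpace H] {T : H →L[ℂ] H} (hT : T.IsPositive) :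
    ∃ S : H →L[ℂ] H, (∀ x y, ⟪S x, y⟫_ℂ = ⟪x, S y⟫_ℂ) ∧ ∀ x, T x = S (S x) := by
  have h0 : 0 ≤ T := (ContinuousLinearMap.nonneg_iff_isPositive T).2 hT
  refine ⟨CFC.sqrt T, ?_, fun x => ?_⟩
  · have h1 := (ContinuousLinearMap.nonneg_iff_isPositive _).1 (CFC.sqrt_nonneg T)
    exact fun x y => h1.inner_left_eq_inner_right x y
  · conv_lhs => rw [← CFC.sqrt_mul_sqrt_self T h0]
    rfl

theorem tsum_enorm_inner_sq (b : HilbertBasis ι ℂ H) (x : H) :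
    ∑' i, ‖⟪b i, x⟫_ℂ‖ₑ ^ 2 = ‖x‖ₑ ^ 2 := by
  have h := b.hasSum_inner_mul_inner x x
  have h' : HasSum (fun i => ‖⟪b i, x⟫_ℂ‖ ^ 2) (‖x‖ ^ 2) := by
    have h2 := Complex.hasSum_re h
    simp only [inner_self_eq_norm_sq_to_K] at h2
    convert h2 using 1
    · ext i
      rw [← inner_conj_symm x (b i), Complex.conj_mul']
      norm_cast
    · norm_cast
  have e : ∀ y : ℝ, 0 ≤ y → ENNReal.ofReal (y ^ 2) = ENNReal.ofReal y ^ 2 :=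
    fun y hy => ENNReal.ofReal_pow hy 2
  rw [← ofReal_norm x, ← e _ (norm_nonneg _), ← h'.tsum_eq,
    ENNReal.ofReal_tsum_of_nonneg (fun i => by positivity) h'.summable]
  exact tsum_congr fun i => by rw [e _ (norm_nonneg _), ofReal_norm]

/-- The squared Hilbert-Schmidt norm with respect to a Hilbert basis. -/
noncomputable def hsSq (b : HilbertBasis ι ℂ H) (A : H →L[ℂ] H) : ℝ≥0∞ := ∑' i, ‖A (b i)‖ₑ ^ 2

/-- By Parseval both sides are the sum of all squared matrix elements, with rows and columns
exchanged. In `ℝ≥0∞` the exchange needs no summability. -/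
theorem hsSq_eq_of_adjoint (b : HilbertBasis ι ℂ H) {A B : H →L[ℂ] H}
    (h : ∀ x y, ⟪A x, y⟫_ℂ = ⟪x, B y⟫_ℂ) : hsSq b A = hsSq b B := by
  unfold hsSq
  simp_rw [← tsum_enorm_inner_sq b]
  rw [ENNReal.tsum_comm]
  refine tsum_congr fun i => tsum_congr fun j => ?_
  rw [← h, ← inner_conj_symm, RCLike.enorm_conj]

theorem hsSq_comp_le (b : HilbertBasis ι ℂ H) (A B : H →L[ℂ] H) :
    hsSq b (A ∘L B) ≤ ‖A‖ₑ ^ 2 * hsSq b B := by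
  unfold hsSq
  rw [← ENNReal.tsum_mul_left]
  refine ENNReal.tsum_le_tsum fun i => ?_
  rw [← mul_pow]
  gcongr
  exact A.le_opENorm _

theorem hsSq_adjoint [CompleteSpace H] (b : HilbertBasis ι ℂ H) (A : H →L[ℂ] H) :
    hsSq b (ContinuousLinearMap.adjoint A) = hsSq b A :=
  hsSq_eq_of_adjoint b fun x y => ContinuousLinearMap.adjoint_inner_left A y x

theorem hsSq_comp_le' [CompleteSpace H] (b : HilbertBasis ι ℂ H) (A B : H →L[ℂ] H) :
    hsSq b (A ∘L B) ≤ hsSq b A * ‖B‖ₑ ^ 2 := by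
  rw [← hsSq_adjoint, ContinuousLinearMap.adjoint_comp, mul_comm, ← hsSq_adjoint b A]
  refine (hsSq_comp_le b _ _).trans_eq ?_
  rw [← ofReal_norm, ← ofReal_norm B, LinearIsometryEquiv.norm_map]

theorem enorm_mul_le_add_sq (x y : ℂ) : ‖x * y‖ₑ ≤ ‖x‖ₑ ^ 2 + ‖y‖ₑ ^ 2 := by
  rw [← ofReal_norm, ← ofReal_norm, ← ofReal_norm,
    ← ENNReal.ofReal_pow (norm_nonneg _), ← ENNReal.ofReal_pow (norm_nonneg _),
    ← ENNReal.ofReal_add (by positivity) (by positivity), norm_mul]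
  apply ENNReal.ofReal_le_ofReal
  nlinarith [sq_nonneg (‖x‖ - ‖y‖), norm_nonneg x, norm_nonneg y]

theorem enorm_inner_le_add_sq (x y : H) : ‖⟪x, y⟫_ℂ‖ₑ ≤ ‖x‖ₑ ^ 2 + ‖y‖ₑ ^ 2 := by
  rw [← ofReal_norm, ← ofReal_norm, ← ofReal_norm,
    ← ENNReal.ofReal_pow (norm_nonneg _), ← ENNReal.ofReal_pow (norm_nonneg _),
    ← ENNReal.ofReal_add (by positivity) (by positivity)]
  apply ENNReal.ofReal_le_ofReal
  nlinarith [sq_nonneg (‖x‖ - ‖y‖), norm_nonneg x, norm_nonneg y, norm_inner_le_norm (𝕜 := ℂ) x y]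

/-- Inserting a resolution of the identity turns both traces into the same double series; the two
Hilbert-Schmidt norms make it absolutely summable, so its order may be reversed. -/
theorem tsum_inner_comp_comm [CompleteSpace H] (b : HilbertBasis ι ℂ H) {A B : H →L[ℂ] H}
    (hA : hsSq b A ≠ ∞) (hB : hsSq b B ≠ ∞) :
    ∑' i, ⟪b i, A (B (b i))⟫_ℂ = ∑' i, ⟪b i, B (A (b i))⟫_ℂ := by
  have key : ∀ (A B : H →L[ℂ] H) (i : ι),
      ⟪b i, A (B (b i))⟫_ℂ = ∑' j, ⟪b i, A (b j)⟫_ℂ * ⟪b j, B (b i)⟫_ℂ := by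
    intro A B i
    rw [← ContinuousLinearMap.adjoint_inner_left, ← b.tsum_inner_mul_inner]
    simp_rw [ContinuousLinearMap.adjoint_inner_left]
  have hs : Summable (Function.uncurry fun i j => ⟪b i, A (b j)⟫_ℂ * ⟪b j, B (b i)⟫_ℂ) := by
    refine Summable.of_enorm (ne_top_of_le_ne_top (ENNReal.add_ne_top.2 ⟨hA, hB⟩) ?_)
    calc ∑' p : ι × ι, ‖Function.uncurry (fun i j => ⟪b i, A (b j)⟫_ℂ * ⟪b j, B (b i)⟫_ℂ) p‖ₑ
        ≤ ∑' p : ι × ι, (‖⟪b p.1, A (b p.2)⟫_ℂ‖ₑ ^ 2 + ‖⟪b p.2, B (b p.1)⟫_ℂ‖ₑ ^ 2) :=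
          ENNReal.tsum_le_tsum fun p => enorm_mul_le_add_sq _ _
      _ = hsSq b A + hsSq b B := by
          rw [ENNReal.tsum_add]
          congr 1
          · rw [ENNReal.tsum_prod', ENNReal.tsum_comm]
            simp_rw [tsum_enorm_inner_sq b]
            rfl
          · rw [ENNReal.tsum_prod']
            simp_rw [tsum_enorm_inner_sq b]
            rfl
  simp_rw [key]
  refine hs.tsum_comm.symm.trans ?_
  exact tsum_congr fun i => tsum_congr fun j => mul_comm _ _

end HilbertSchmidt

/-- Orthonormal vectors lie √2 apart, so balls of radius 1/2 around them are disjoint. Countability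
is what allows traces to be treated as countable sums of measurable functions. -/
theorem countable_of_orthonormal {H : Type*} [NormedAddCommGroup H] [InnerProductSpace ℂ H]
    [TopologicalSpace.SeparableSpace H] {ι : Type*} {v : ι → H} (hv : Orthonormal ℂ v) :
    Countable ι := by
  refine Pairwise.countable_of_isOpen_disjoint (s := fun i => Metric.ball (v i) (1 / 2))
    (fun i j hij => ?_) (fun i => Metric.isOpen_ball) (fun i => ⟨v i, by simp⟩)
  refine Metric.ball_disjoint_ball ?_
  have h : ‖v i - v j‖ ^ 2 = 2 := by
    rw [@norm_sub_sq ℂ, hv.1, hv.1, hv.2 hij]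
    norm_num
  rw [dist_eq_norm]
  nlinarith [norm_nonneg (v i - v j)]

instance countable_modeBasis_index (n : ℕ) :
    Countable (exists_hilbertBasis ℂ (ModeSpace n)).choose := by
  have : Fact ((2 : ℝ≥0∞) ≠ ∞) := ⟨by norm_num⟩
  exact countable_of_orthonormal (modeBasis n).orthonormal

/-! ### Density operators: square roots, trace bounds, exchange of trace and integral -/

section Density

variable {n : ℕ}

theorem inner_symmetric_sq {H : Type*} [NormedAddCommGroup H] [InnerProductSpace ℂ H]
    {S : H →L[ℂ] H} (hS : ∀ x y, ⟪S x, y⟫_ℂ = ⟪x, S y⟫_ℂ) (x : H) :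
    ⟪x, S (S x)⟫_ℂ = ((‖S x‖ ^ 2 : ℝ) : ℂ) := by
  rw [← hS, inner_self_eq_norm_sq_to_K]
  norm_cast

theorem IsDensityOp.exists_sqrt {T : ModeOp n} (hT : IsDensityOp T) :
    ∃ S : ModeOp n, (∀ x y, ⟪S x, y⟫_ℂ = ⟪x, S y⟫_ℂ) ∧ (∀ x, T x = S (S x)) ∧
      hsSq (modeBasis n) S = 1 := by
  obtain ⟨S, hS, hT'⟩ := exists_symmetric_sq hT.1
  refine ⟨S, hS, hT', ?_⟩
  have h : HasSum (fun i => ‖S (modeBasis n i)‖ ^ 2) 1 := by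
    have h2 := Complex.hasSum_re hT.2
    simp only [hT', inner_symmetric_sq hS, Complex.ofReal_re, Complex.one_re] at h2
    exact h2
  rw [← ENNReal.ofReal_one, ← h.tsum_eq,
    ENNReal.ofReal_tsum_of_nonneg (fun i => by positivity) h.summable]
  exact tsum_congr fun i => by rw [ENNReal.ofReal_pow (norm_nonneg _), ofReal_norm]

theorem isDensityOp_of_sq {S T : ModeOp n} (hS : ∀ x y, ⟪S x, y⟫_ℂ = ⟪x, S y⟫_ℂ)
    (hT : ∀ x, T x = S (S x)) (h1 : hsSq (modeBasis n) S = 1) : IsDensityOp T := by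
  refine ⟨⟨fun x y => ?_, fun x => ?_⟩, ?_⟩
  · change ⟪T x, y⟫_ℂ = ⟪x, T y⟫_ℂ
    rw [hT, hT, hS, hS]
  · rw [ContinuousLinearMap.reApplyInnerSelf_apply, hT, hS, inner_self_eq_norm_sq]
    positivity
  · simp only [hT, inner_symmetric_sq hS]
    rw [← Complex.ofReal_one]
    refine Complex.hasSum_ofReal.2 ?_
    have e : ∀ i, ‖S (modeBasis n i)‖ₑ ^ 2 = ENNReal.ofReal (‖S (modeBasis n i)‖ ^ 2) := fun i => by
      rw [ENNReal.ofReal_pow (norm_nonneg _), ofReal_norm]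
    unfold hsSq at h1
    simp_rw [e] at h1
    have h2 : Summable fun i => ‖S (modeBasis n i)‖ ^ 2 := by
      have := ENNReal.summable_toReal (f := fun i => ENNReal.ofReal (‖S (modeBasis n i)‖ ^ 2))
        (by rw [h1]; simp)
      simpa [ENNReal.toReal_ofReal, sq_nonneg] using this
    rw [← ENNReal.ofReal_tsum_of_nonneg (fun i => by positivity) h2, ENNReal.ofReal_eq_one] at h1
    rw [← h1]
    exact h2.hasSum

theorem conj_apply (U : ModeUnitary n) (T : ModeOp n) (x : ModeSpace n) :
    conj U T x = U (T (U.symm x)) := rfl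

theorem IsDensityOp.conj {T : ModeOp n} (hT : IsDensityOp T) (U : ModeUnitary n) :
    IsDensityOp (conj U T) := by
  obtain ⟨S, hS, hT', h1⟩ := hT.exists_sqrt
  refine isDensityOp_of_sq (S := GKP.conj U S) (fun x y => ?_) (fun x => ?_) ?_
  · rw [conj_apply, conj_apply]
    nth_rw 1 [← U.apply_symm_apply y]
    nth_rw 2 [← U.apply_symm_apply x]
    rw [U.inner_map_map, U.inner_map_map, hS]
  · simp only [conj_apply, hT', U.symm_apply_apply]
  · have h2 : hsSq (modeBasis n) (GKP.conj U S) =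
        hsSq (modeBasis n) (S ∘L (U.symm : ModeSpace n →L[ℂ] ModeSpace n)) := by
      refine tsum_congr fun i => ?_
      rw [conj_apply, LinearIsometryEquiv.enorm_map]
      rfl
    have h3 : hsSq (modeBasis n) (S ∘L (U.symm : ModeSpace n →L[ℂ] ModeSpace n)) =
        hsSq (modeBasis n) ((U : ModeSpace n →L[ℂ] ModeSpace n) ∘L S) := by
      refine hsSq_eq_of_adjoint _ fun x y => ?_
      change ⟪S (U.symm x), y⟫_ℂ = ⟪x, U (S y)⟫_ℂ
      rw [hS, ← U.inner_map_map, U.apply_symm_apply]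
    rw [h2, h3, ← h1]
    refine tsum_congr fun i => ?_
    change ‖U (S (modeBasis n i))‖ₑ ^ 2 = _
    rw [LinearIsometryEquiv.enorm_map]

theorem IsDensityOp.norm_le_one {T : ModeOp n} (hT : IsDensityOp T) : ‖T‖ ≤ 1 := by
  obtain ⟨S, hS, hT', h1⟩ := hT.exists_sqrt
  have h : ∀ x, ‖S x‖ ≤ ‖x‖ := by
    intro x
    have h2 : ‖S x‖ₑ ^ 2 ≤ ‖x‖ₑ ^ 2 := by
      rw [← tsum_enorm_inner_sq (modeBasis n)]
      calc ∑' i, ‖⟪modeBasis n i, S x⟫_ℂ‖ₑ ^ 2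
          ≤ ∑' i, ‖S (modeBasis n i)‖ₑ ^ 2 * ‖x‖ₑ ^ 2 := by
            refine ENNReal.tsum_le_tsum fun i => ?_
            rw [← hS, ← mul_pow]
            gcongr
            rw [← ofReal_norm, ← ofReal_norm, ← ofReal_norm,
              ← ENNReal.ofReal_mul (norm_nonneg _)]
            exact ENNReal.ofReal_le_ofReal (norm_inner_le_norm _ _)
        _ = ‖x‖ₑ ^ 2 := by
            rw [ENNReal.tsum_mul_right]
            change hsSq (modeBasis n) S * _ = _
            rw [h1, one_mul]
    rw [← ofReal_norm, ← ofReal_norm, ← ENNReal.ofReal_pow (norm_nonneg _),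
      ← ENNReal.ofReal_pow (norm_nonneg _), ENNReal.ofReal_le_ofReal_iff (by positivity)] at h2
    exact le_of_sq_le_sq h2 (norm_nonneg x)
  refine ContinuousLinearMap.opNorm_le_bound _ zero_le_one fun x => ?_
  rw [hT', one_mul]
  exact (h _).trans (h x)

/-- With T = S², each term is ⟨S E† eᵢ, S eᵢ⟩, and both factors have controlled Hilbert-Schmidt
norm. The crude bound suffices because only its uniformity in T matters. -/
theorem IsDensityOp.tsum_enorm_inner_le {T : ModeOp n} (hT : IsDensityOp T) (E : ModeOp n) :
    ∑' i, ‖⟪modeBasis n i, E (T (modeBasis n i))⟫_ℂ‖ₑ ≤ ‖E‖ₑ ^ 2 + 1 := by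
  obtain ⟨S, hS, hT', h1⟩ := hT.exists_sqrt
  calc ∑' i, ‖⟪modeBasis n i, E (T (modeBasis n i))⟫_ℂ‖ₑ
      ≤ ∑' i, (‖S (ContinuousLinearMap.adjoint E (modeBasis n i))‖ₑ ^ 2
          + ‖S (modeBasis n i)‖ₑ ^ 2) := by
        refine ENNReal.tsum_le_tsum fun i => ?_
        rw [← ContinuousLinearMap.adjoint_inner_left, hT', ← hS]
        exact enorm_inner_le_add_sq _ _
    _ = hsSq (modeBasis n) (S ∘L ContinuousLinearMap.adjoint E) + hsSq (modeBasis n) S :=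
        ENNReal.tsum_add
    _ ≤ ‖E‖ₑ ^ 2 + 1 := by
        rw [h1]
        gcongr
        refine (hsSq_comp_le' _ _ _).trans_eq ?_
        rw [h1, one_mul, ← ofReal_norm, LinearIsometryEquiv.norm_map, ofReal_norm]

theorem IsDensityOp.summable_inner {T : ModeOp n} (hT : IsDensityOp T) (E : ModeOp n) :
    Summable fun i => ⟪modeBasis n i, E (T (modeBasis n i))⟫_ℂ :=
  Summable.of_enorm (ne_top_of_le_ne_top (by finiteness) (hT.tsum_enorm_inner_le E))

theorem IsDensityOp.norm_opTrace_comp_le {T : ModeOp n} (hT : IsDensityOp T) (E : ModeOp n) :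
    ‖opTrace (E ∘L T)‖ ≤ ‖E‖ ^ 2 + 1 := by
  have h := (enorm_tsum_le_tsum_enorm.trans (hT.tsum_enorm_inner_le E) :
    ‖opTrace (E ∘L T)‖ₑ ≤ ‖E‖ₑ ^ 2 + 1)
  rwa [← ofReal_norm, ← ofReal_norm, ← ENNReal.ofReal_pow (norm_nonneg _), ← ENNReal.ofReal_one,
    ← ENNReal.ofReal_add (by positivity) zero_le_one,
    ENNReal.ofReal_le_ofReal_iff (by positivity)] at h

/-- Cyclicity moves one factor S of T = S² to the front: Tr(R S S) = Tr(S R S), a series of terms ⟨S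
eᵢ, R S eᵢ⟩ ≥ 0. -/
theorem IsDensityOp.opTrace_comp_nonneg {T R : ModeOp n} (hR : IsDensityOp R)
    (hT : IsDensityOp T) : 0 ≤ opTrace (R ∘L T) := by
  obtain ⟨S, hS, hT', h1⟩ := hT.exists_sqrt
  have h2 : hsSq (modeBasis n) (R ∘L S) ≠ ∞ :=
    ne_top_of_le_ne_top (by rw [h1]; finiteness) (hsSq_comp_le _ R S)
  have h3 := tsum_inner_comp_comm (modeBasis n) h2 (B := S) (by rw [h1]; simp)
  have h4 : opTrace (R ∘L T) = ∑' i, ⟪modeBasis n i, (R ∘L S) (S (modeBasis n i))⟫_ℂ := by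
    unfold opTrace
    simp only [ContinuousLinearMap.comp_apply, hT']
  rw [h4, h3]
  refine tsum_nonneg fun i => ?_
  rw [← hS]
  exact hR.1.inner_nonneg_right _

variable {W : Type*} [MeasurableSpace W] {κ : Measure W}

theorem aestronglyMeasurable_opTrace_comp {A : W → ModeOp n}
    (hA : AEStronglyMeasurable A κ)
    (hs : ∀ w, Summable fun i => ⟪modeBasis n i, A w (modeBasis n i)⟫_ℂ) :
    AEStronglyMeasurable (fun w => opTrace (A w)) κ := by
  refine aestronglyMeasurable_of_tendsto_ae atTop
    (f := fun (s : Finset _) w => ∑ i ∈ s, ⟪modeBasis n i, A w (modeBasis n i)⟫_ℂ) (fun s => ?_)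
    (ae_of_all _ fun w => (hs w).hasSum)
  refine Finset.aestronglyMeasurable_fun_sum _ fun i _ => ?_
  exact aestronglyMeasurable_const.inner (hA.apply_continuousLinearMap _)

/-- Each diagonal matrix element is a norm-continuous functional and passes through the integral;
the uniform absolute bound on the diagonal series, integrable as κ is finite, justifies summing
afterwards. -/
theorem opTrace_comp_integral [IsFiniteMeasure κ] (E : ModeOp n) {T : W → ModeOp n}
    (hT : AEStronglyMeasurable T κ) (hd : ∀ w, IsDensityOp (T w)) :
    opTrace (E ∘L ∫ w, T w ∂κ) = ∫ w, opTrace (E ∘L T w) ∂κ := by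
  have hint : Integrable T κ :=
    Integrable.of_bound hT 1 (ae_of_all _ fun w => (hd w).norm_le_one)
  have hm : ∀ i, AEStronglyMeasurable
      (fun w => ⟪modeBasis n i, E (T w (modeBasis n i))⟫_ℂ) κ := fun i =>
    aestronglyMeasurable_const.inner
      (E.continuous.comp_aestronglyMeasurable (hT.apply_continuousLinearMap _))
  unfold opTrace
  simp only [ContinuousLinearMap.comp_apply]
  rw [integral_tsum hm]
  · refine tsum_congr fun i => ?_
    let L : ModeOp n →L[ℂ] ℂ := (innerSL ℂ (modeBasis n i)) ∘L E ∘L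
      (ContinuousLinearMap.apply ℂ (ModeSpace n) (modeBasis n i))
    exact (L.integral_comp_comm hint).symm
  · rw [← lintegral_tsum fun i => (hm i).enorm]
    refine ne_top_of_le_ne_top ?_ (lintegral_mono fun w => (hd w).tsum_enorm_inner_le E)
    rw [lintegral_const]
    finiteness

end Density
-- The twirled channel as the mean of the snapshots
section Twirl

variable {n d : ℕ} {C : ScaledCode n d} {Z : Type*} [MeasurableSpace Z]

instance instMeasurableSingletonClassGate : MeasurableSingletonClass (Gate C) :=
  ⟨fun _ => MeasurableSpace.measurableSet_top⟩

/-- A `PMF` lives on countably many gates, so the product measure is carried by countably many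
slices and measurability in z alone is enough. -/
theorem aestronglyMeasurable_pmf_prod {F : Type*} [TopologicalSpace F]
    [TopologicalSpace.PseudoMetrizableSpace F] (μ : PMF (Gate C)) (ν : Measure Z) [SigmaFinite ν]
    {f : Gate C × Z → F} (hf : ∀ g, StronglyMeasurable fun z => f (g, z)) :
    AEStronglyMeasurable f (μ.toMeasure.prod ν) := by
  have hc : Countable μ.support := μ.support_countable
  have hr : (μ.toMeasure.prod ν).restrict (⋃ g : μ.support, {(g : Gate C)} ×ˢ Set.univ) =
      μ.toMeasure.prod ν := by
    refine Measure.restrict_eq_self_of_ae_mem ?_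
    have h1 : ∀ᵐ g ∂μ.toMeasure, g ∈ μ.support := by
      rw [ae_iff]
      change μ.toMeasure μ.supportᶜ = 0
      rw [PMF.toMeasure_apply_eq_zero_iff _ MeasurableSpace.measurableSet_top]
      exact disjoint_compl_right
    filter_upwards [Measure.quasiMeasurePreserving_fst.ae h1] with x hx
    exact Set.mem_iUnion.2 ⟨⟨x.1, hx⟩, by simp⟩
  rw [← hr, aestronglyMeasurable_iUnion_iff]
  intro g
  refine ((hf g).comp_measurable measurable_snd).aestronglyMeasurable.congr ?_
  filter_upwards [ae_restrict_mem ((measurableSet_singleton _).prod MeasurableSet.univ)] with x hx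
  have : x.1 = g := by simpa using hx
  simp [← this]

/-- The unitary channel as a linear isometry of the bounded operators. -/
noncomputable def conjIsometry (U : ModeUnitary n) : ModeOp n →ₗᵢ[ℂ] ModeOp n where
  toFun := conj U
  map_add' S T := by ext x; simp [conj_apply]
  map_smul' c T := by ext x; simp [conj_apply]
  norm_map' T := by
    change ‖conj U T‖ = ‖T‖
    refine le_antisymm (ContinuousLinearMap.opNorm_le_bound _ (norm_nonneg _) fun x => ?_)
      (ContinuousLinearMap.opNorm_le_bound _ (norm_nonneg _) fun x => ?_)
    · rw [conj_apply, U.norm_map]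
      simpa using T.le_opNorm (U.symm x)
    · simpa [conj_apply] using (conj U T).le_opNorm (U x)

/-- Conjugation is isometric, so integrability on either side is equivalent and no integrability
hypothesis is needed. -/
theorem conj_integral (U : ModeUnitary n) (ν : Measure Z) (f : Z → ModeOp n) :
    conj U (∫ z, f z ∂ν) = ∫ z, conj U (f z) ∂ν :=
  ((conjIsometry U).integral_comp_comm f).symm

variable {ν : Measure Z} {Pi : Z → ModeOp n} {ρ : ModeOp n}

theorem conj_smul (U : ModeUnitary n) (c : ℂ) (T : ModeOp n) : conj U (c • T) = c • conj U T :=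
  (conjIsometry U).map_smul c T

theorem aestronglyMeasurable_pointer [SigmaFinite ν] (hPi : IsPOVM ν Pi) (μ : PMF (Gate C))
    (U : SymplAut C → ModeUnitary n) :
    AEStronglyMeasurable (fun x : Gate C × Z => conj (gateUnitary U x.1) (Pi x.2))
      (μ.toMeasure.prod ν) :=
  aestronglyMeasurable_pmf_prod μ ν fun g =>
    (conjIsometry (gateUnitary U g)).continuous.comp_stronglyMeasurable hPi.measurable

theorem aemeasurable_bornDensity [SigmaFinite ν] (hPi : IsPOVM ν Pi) (μ : PMF (Gate C))
    (U : SymplAut C → ModeUnitary n) (hρ : IsDensityOp ρ) :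
    AEMeasurable (fun x : Gate C × Z =>
      ENNReal.ofReal (opTrace (Pi x.2 ∘L conj (gateUnitary U x.1).symm ρ)).re)
      (μ.toMeasure.prod ν) := by
  have h1 : AEStronglyMeasurable (fun x : Gate C × Z =>
      Pi x.2 ∘L conj (gateUnitary U x.1).symm ρ) (μ.toMeasure.prod ν) := by
    refine aestronglyMeasurable_pmf_prod μ ν fun g => ?_
    exact ((ContinuousLinearMap.compL ℂ (ModeSpace n) (ModeSpace n) (ModeSpace n)).flip
      (conj (gateUnitary U g).symm ρ)).continuous.comp_stronglyMeasurable hPi.measurable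
  have h2 := aestronglyMeasurable_opTrace_comp h1 fun x => (hρ.conj _).summable_inner _
  exact (Complex.measurable_re.comp_aemeasurable h2.aemeasurable).ennreal_ofReal

theorem twirl_povmChannel_eq_integral [SigmaFinite ν] (hPi : IsPOVM ν Pi) (μ : PMF (Gate C))
    (U : SymplAut C → ModeUnitary n) (hρ : IsDensityOp ρ)
    [IsFiniteMeasure (sampleLaw ν Pi μ U ρ)] :
    twirl μ U (povmChannel ν Pi) ρ =
      ∫ x, conj (gateUnitary U x.1) (Pi x.2) ∂sampleLaw ν Pi μ U ρ := by
  have hf := aemeasurable_bornDensity hPi μ U hρ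
  have hint : Integrable (fun x : Gate C × Z => conj (gateUnitary U x.1) (Pi x.2))
      (sampleLaw ν Pi μ U ρ) :=
    Integrable.of_bound ((aestronglyMeasurable_pointer hPi μ U).mono_ac
      (withDensity_absolutelyContinuous _ _)) 1
      (ae_of_all _ fun x => ((hPi.density x.2).conj _).norm_le_one)
  have hlt : ∀ᵐ x ∂μ.toMeasure.prod ν,
      ENNReal.ofReal (opTrace (Pi x.2 ∘L conj (gateUnitary U x.1).symm ρ)).re < ∞ :=
    ae_of_all _ fun _ => ENNReal.ofReal_lt_top
  unfold sampleLaw at hint ⊢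
  rw [integrable_withDensity_iff_integrable_smul₀' hf hlt] at hint
  rw [integral_withDensity_eq_integral_toReal_smul₀ hf hlt, integral_prod _ hint,
    PMF.integral_eq_tsum _ _ hint.integral_prod_left]
  refine tsum_congr fun g => ?_
  rw [povmChannel, conj_integral]
  rw [Complex.coe_smul]
  congr 1
  refine integral_congr_ae (ae_of_all _ fun z => ?_)
  -- The Born weight is real and nonnegative, so neither the real part nor `ENNReal.ofReal` in the
  -- sample law changes it.
  have h0 := (hPi.density z).opTrace_comp_nonneg (hρ.conj (gateUnitary U g).symm)
  rw [Complex.le_def] at h0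
  simp only [conj_smul, Complex.zero_re, Complex.zero_im] at h0 ⊢
  rw [ENNReal.toReal_ofReal h0.1]
  have h1 : opTrace (Pi z ∘L conj (gateUnitary U g).symm ρ) =
      ((opTrace (Pi z ∘L conj (gateUnitary U g).symm ρ)).re : ℂ) := Complex.ext rfl h0.2.symm
  conv_lhs => rw [h1]
  exact Complex.coe_smul _ _

theorem decode_twirl_apply [SigmaFinite ν] (hPi : IsPOVM ν Pi) (μ : PMF (Gate C))
    (U : SymplAut C → ModeUnitary n) (hρ : IsDensityOp ρ)
    [IsFiniteMeasure (sampleLaw ν Pi μ U ρ)] (E : LogIdx n d → LogIdx n d → ModeOp n)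
    (j k : LogIdx n d) :
    decode E (twirl μ U (povmChannel ν Pi) ρ) j k =
      ∫ x, decode E (conj (gateUnitary U x.1) (Pi x.2)) j k ∂sampleLaw ν Pi μ U ρ := by
  rw [twirl_povmChannel_eq_integral hPi μ U hρ]
  exact opTrace_comp_integral (E j k) ((aestronglyMeasurable_pointer hPi μ U).mono_ac
    (withDensity_absolutelyContinuous _ _)) fun x => (hPi.density x.2).conj _

theorem aestronglyMeasurable_decode_pointer [SigmaFinite ν] (hPi : IsPOVM ν Pi) (μ : PMF (Gate C))
    (U : SymplAut C → ModeUnitary n) (E : LogIdx n d → LogIdx n d → ModeOp n)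
    (j k : LogIdx n d) :
    AEStronglyMeasurable
      (fun x : Gate C × Z => decode E (conj (gateUnitary U x.1) (Pi x.2)) j k)
      (sampleLaw ν Pi μ U ρ) := by
  refine aestronglyMeasurable_opTrace_comp (A := fun x : Gate C × Z =>
    E j k ∘L conj (gateUnitary U x.1) (Pi x.2)) ?_
    fun x => ((hPi.density x.2).conj _).summable_inner _
  exact (ContinuousLinearMap.compL ℂ (ModeSpace n) (ModeSpace n) (ModeSpace n)
    (E j k)).continuous.comp_aestronglyMeasurable ((aestronglyMeasurable_pointer hPi μ U).mono_ac
      (withDensity_absolutelyContinuous _ _))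

theorem integrable_decode_pointer [SigmaFinite ν] (hPi : IsPOVM ν Pi) (μ : PMF (Gate C))
    (U : SymplAut C → ModeUnitary n) [IsFiniteMeasure (sampleLaw ν Pi μ U ρ)]
    (E : LogIdx n d → LogIdx n d → ModeOp n) (j k : LogIdx n d) :
    Integrable (fun x : Gate C × Z => decode E (conj (gateUnitary U x.1) (Pi x.2)) j k)
      (sampleLaw ν Pi μ U ρ) :=
  Integrable.of_bound (aestronglyMeasurable_decode_pointer hPi μ U E j k) (‖E j k‖ ^ 2 + 1)
    (ae_of_all _ fun x => ((hPi.density x.2).conj _).norm_opTrace_comp_le _)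

theorem decode_shadow_apply {N : ℕ} (hPi : IsPOVM ν Pi) (U : SymplAut C → ModeUnitary n)
    (E : LogIdx n d → LogIdx n d → ModeOp n) (s : Fin N → Gate C × Z) (j k : LogIdx n d) :
    decode E (shadow Pi U s) j k =
      (N : ℂ)⁻¹ * ∑ i, decode E (conj (gateUnitary U (s i).1) (Pi (s i).2)) j k := by
  simp only [decode, shadow, opTrace, Matrix.of_apply, ContinuousLinearMap.comp_apply,
    _root_.smul_apply, _root_.sum_apply, map_smul, map_sum,
    inner_smul_right, inner_sum]
  rw [tsum_mul_left, Summable.tsum_finsetSum fun i _ =>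
    ((hPi.density (s i).2).conj _).summable_inner _]

end Twirl
-- Real coordinates of Hermitian matrices and logical distances
section Coordinates

/-- The functional `z ↦ Re z + Im z`. Applied to the entries of a Hermitian matrix it gives real
coordinates that are orthonormal for the Hilbert-Schmidt inner product. -/
noncomputable def reAddIm : ℂ →L[ℝ] ℝ := Complex.reCLM + Complex.imCLM

theorem reAddIm_apply (z : ℂ) : reAddIm z = z.re + z.im := rfl

variable {ι : Type*} [Fintype ι]

theorem trace_conjTranspose_mul_self_re (A : Matrix ι ι ℂ) :
    ((Aᴴ * A).trace).re = ∑ j, ∑ k, ((A j k).re ^ 2 + (A j k).im ^ 2) := by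
  rw [Finset.sum_comm]
  simp only [Matrix.trace, Matrix.diag_apply, Matrix.mul_apply, Matrix.conjTranspose_apply,
    Complex.re_sum]
  refine Finset.sum_congr rfl fun j _ => Finset.sum_congr rfl fun k _ => ?_
  simp
  ring

theorem trace_conjTranspose_mul_self_re_eq_sum_sq {A : Matrix ι ι ℂ} (hA : A.IsHermitian) :
    ((Aᴴ * A).trace).re = ∑ j, ∑ k, reAddIm (A j k) ^ 2 := by
  -- The cross terms of (Re + Im)² cancel: Re is symmetric and Im antisymmetric in j, k.
  have h0 : ∑ j, ∑ k, (A j k).re * (A j k).im = 0 := by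
    have h1 : ∑ j, ∑ k, (A j k).re * (A j k).im = -∑ j, ∑ k, (A j k).re * (A j k).im := by
      conv_lhs => rw [Finset.sum_comm]
      simp_rw [← Finset.sum_neg_distrib]
      refine Finset.sum_congr rfl fun j _ => Finset.sum_congr rfl fun k _ => ?_
      rw [← hA.apply k j]
      simp
    linarith
  have h2 : ∑ j, ∑ k, reAddIm (A j k) ^ 2 =
      ∑ j, ∑ k, ((A j k).re ^ 2 + (A j k).im ^ 2) + 2 * ∑ j, ∑ k, (A j k).re * (A j k).im := by
    simp_rw [Finset.mul_sum, ← Finset.sum_add_distrib, reAddIm_apply]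
    exact Finset.sum_congr rfl fun j _ => Finset.sum_congr rfl fun k _ => by ring
  rw [trace_conjTranspose_mul_self_re, h2, h0]
  ring

theorem abs_reAddIm_le_one [DecidableEq ι] {A : Matrix ι ι ℂ} (hA : A.PosSemidef)
    (ht : A.trace = 1) (j k : ι) : |reAddIm (A j k)| ≤ 1 := by
  have hd : ∀ i, 0 ≤ (A i i).re ∧ (A i i).im = 0 := fun i => by
    have := hA.diag_nonneg (i := i)
    rw [Complex.le_def] at this
    exact ⟨this.1, this.2.symm⟩
  have ht' : ∑ i, (A i i).re = 1 := by
    have := congrArg Complex.re ht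
    simpa [Matrix.trace] using this
  by_cases hjk : j = k
  · subst hjk
    rw [reAddIm_apply, (hd j).2, add_zero, abs_of_nonneg (hd j).1, ← ht']
    exact Finset.single_le_sum (f := fun i => (A i i).re) (fun i _ => (hd i).1)
      (Finset.mem_univ j)
  · have h2 : (A j j).re + (A k k).re ≤ 1 := by
      rw [← ht', ← Finset.sum_pair (f := fun i => (A i i).re) hjk]
      exact Finset.sum_le_sum_of_subset_of_nonneg (Finset.subset_univ _) fun i _ _ => (hd i).1
    -- Positivity on the test vector e_j + c e_k. The choices c = ±(1 - i) make the cross term ±2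
    -- (Re + Im), whence 2 |Re + Im| ≤ A_jj + 2 A_kk ≤ 2.
    have h3 : ∀ c : ℂ, 0 ≤ (A j j).re + (c.re ^ 2 + c.im ^ 2) * (A k k).re
        + 2 * (c.re * (A j k).re - c.im * (A j k).im) := by
      intro c
      have h4 := hA.dotProduct_mulVec_nonneg (Pi.single j 1 + c • Pi.single k 1)
      rw [Complex.le_def] at h4
      have h5 := h4.1
      have h6 : A k j = star (A j k) := (hA.1.apply k j).symm
      simp [Matrix.mulVec_add, Matrix.mulVec_smul, add_dotProduct, dotProduct_add,
        h6, (hd k).2] at h5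
      nlinarith [h5]
    rw [reAddIm_apply, abs_le]
    have hp := h3 ⟨1, -1⟩
    have hm := h3 ⟨-1, 1⟩
    simp only at hp hm
    constructor <;> nlinarith [(hd j).1, (hd k).1]

theorem dHS_depolInv {n d : ℕ} {α : ℝ} (hα : α ≠ 0) (β : ℝ) (X Y : LogOp n d) :
    dHS X (depolInv α β Y) = (α ^ 2)⁻¹ *
      (((Y - ((α : ℂ) • X + (β : ℂ) • 1))ᴴ * (Y - ((α : ℂ) • X + (β : ℂ) • 1))).trace).re := by
  have h : X - depolInv α β Y = (-(α : ℂ)⁻¹) • (Y - ((α : ℂ) • X + (β : ℂ) • 1)) := by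
    have hα' : (α : ℂ) ≠ 0 := by exact_mod_cast hα
    have h1 : X = ((α : ℂ)⁻¹ * α) • X := by rw [inv_mul_cancel₀ hα', one_smul]
    rw [depolInv]
    nth_rw 1 [h1]
    module
  rw [dHS, h, Matrix.conjTranspose_smul, Matrix.smul_mul, Matrix.mul_smul, smul_smul,
    Matrix.trace_smul]
  have h2 : star (-(α : ℂ)⁻¹) * -(α : ℂ)⁻¹ = (((α ^ 2)⁻¹ : ℝ) : ℂ) := by
    simp
    ring
  rw [h2, smul_eq_mul, Complex.re_ofReal_mul]

/-- Cauchy-Schwarz over the d^n singular values, whose squares sum to the Hilbert-Schmidt distance.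
-/
theorem traceDist_le_of_dHS_le {n d : ℕ} {X Y : LogOp n d} {δ : ℝ} (hδ : 0 ≤ δ)
    (h : dHS X Y ≤ δ ^ 2) : traceDist X Y ≤ (d : ℝ) ^ ((n : ℝ) / 2) * (δ / 2) := by
  have hH := Matrix.isHermitian_conjTranspose_mul_self (X - Y)
  have h0 : ∀ i, 0 ≤ hH.eigenvalues i :=
    (Matrix.posSemidef_conjTranspose_mul_self (X - Y)).eigenvalues_nonneg
  have h1 : ∑ i, hH.eigenvalues i = dHS X Y := by
    rw [dHS, hH.trace_eq_sum_eigenvalues]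
    simp
  have h2 : traceNorm (X - Y) ^ 2 ≤ (d : ℝ) ^ n * δ ^ 2 := by
    have h3 := sq_sum_le_card_mul_sum_sq (s := Finset.univ)
      (f := fun i => Real.sqrt (hH.eigenvalues i))
    simp_rw [Real.sq_sqrt (h0 _), h1] at h3
    refine h3.trans ?_
    simp only [Finset.card_univ, Fintype.card_fun, Fintype.card_fin, Nat.cast_pow]
    gcongr
  have h4 : (d : ℝ) ^ n = ((d : ℝ) ^ ((n : ℝ) / 2)) ^ 2 := by
    rw [← Real.rpow_natCast _ 2, ← Real.rpow_mul (by positivity), ← Real.rpow_natCast]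
    norm_num
  rw [h4, ← mul_pow] at h2
  have h5 := le_of_sq_le_sq h2 (by positivity)
  rw [traceDist]
  linarith

end Coordinates

/-! ### Hoeffding's inequality for bounded means -/

section Hoeffding

variable {Ω : Type*} [MeasurableSpace Ω] {Pr : Measure Ω} [IsProbabilityMeasure Pr]

/-- Hoeffding's inequality for the upper tail of a sum of variables with values in `[-1, 1]`. -/
theorem measureReal_sum_sub_integral_ge_le {N : ℕ} {Y : Fin N → Ω → ℝ} (hind : iIndepFun Y Pr)
    (hm : ∀ i, AEMeasurable (Y i) Pr) (hb : ∀ i ω, |Y i ω| ≤ 1) {ε : ℝ} (hε : 0 ≤ ε) :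
    Pr.real {ω | N * ε ≤ ∑ i, (Y i ω - ∫ ω', Y i ω' ∂Pr)} ≤ Real.exp (-(N * ε ^ 2 / 2)) := by
  have h1 : ∀ i ∈ Finset.univ, HasSubgaussianMGF (fun ω => Y i ω - ∫ ω', Y i ω' ∂Pr) 1 Pr := by
    intro i _
    have h2 := hasSubgaussianMGF_of_mem_Icc (a := -1) (b := 1) (hm i)
      (ae_of_all _ fun ω => abs_le.1 (hb i ω))
    -- Hoeffding's lemma: the variance proxy is the square of half the length of [-1, 1].
    have h3 : (‖(1 : ℝ) - -1‖₊ / 2) ^ 2 = 1 := by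
      ext
      norm_num
    rwa [h3] at h2
  have h4 : iIndepFun (fun i ω => Y i ω - ∫ ω', Y i ω' ∂Pr) Pr :=
    hind.comp (fun i y => y - ∫ ω', Y i ω' ∂Pr) fun i => measurable_id.sub_const _
  refine (HasSubgaussianMGF.measure_sum_ge_le_of_iIndepFun h4 h1 (by positivity)).trans ?_
  rcases Nat.eq_zero_or_pos N with rfl | hN
  · simp
  · rw [Real.exp_le_exp]
    have : (N : ℝ) ≠ 0 := by positivity
    simp
    field_simp
    rfl

theorem measureReal_abs_mean_sub_ge_le {N : ℕ} (hN : 0 < N) {Y : Fin N → Ω → ℝ}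
    (hind : iIndepFun Y Pr) (hm : ∀ i, AEMeasurable (Y i) Pr) (hb : ∀ i ω, |Y i ω| ≤ 1) {m : ℝ}
    (hmean : ∀ i, ∫ ω, Y i ω ∂Pr = m) {ε : ℝ} (hε : 0 ≤ ε) :
    Pr.real {ω | ε ≤ |(N : ℝ)⁻¹ * ∑ i, Y i ω - m|} ≤ 2 * Real.exp (-(N * ε ^ 2 / 2)) := by
  have hN' : (0 : ℝ) < N := by exact_mod_cast hN
  have h1 := measureReal_sum_sub_integral_ge_le hind hm hb hε
  have h2 := measureReal_sum_sub_integral_ge_le (Y := fun i ω => -Y i ω)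
    (hind.comp (fun _ y => -y) fun _ => measurable_neg) (fun i => (hm i).neg)
    (fun i ω => by rw [abs_neg]; exact hb i ω) hε
  rw [two_mul]
  refine le_trans ?_ (add_le_add h1 h2)
  refine le_trans (measureReal_mono ?_) (measureReal_union_le _ _)
  intro ω hω
  have hω' : ε ≤ |(N : ℝ)⁻¹ * ∑ i, Y i ω - m| := hω
  have e : ∀ x, (N : ℝ)⁻¹ * x - m = (N : ℝ)⁻¹ * (x - N * m) := fun x => by
    field_simp
  rw [e, abs_mul, abs_of_pos (inv_pos.2 hN'), inv_mul_eq_div, le_div_iff₀ hN', mul_comm] at hω'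
  rcases le_abs.1 hω' with h | h
  · left
    simpa [hmean] using h
  · right
    change N * ε ≤ ∑ i, (-Y i ω - ∫ ω', -Y i ω' ∂Pr)
    simp only [integral_neg, hmean]
    refine h.trans_eq ?_
    rw [Finset.sum_sub_distrib, Finset.sum_neg_distrib]
    simp
    ring

end Hoeffding
-- Sample size, union bound and passage from coordinates to distance
theorem unionBound_le_of_sampleSize {n d N : ℕ} (hd : 1 ≤ d) {α δ δHS : ℝ} (hα : α ≠ 0)
    (hδ : 0 < δ) (hδHS : 0 < δHS)
    (hN : 2 * (d : ℝ) ^ (2 * n) / (α ^ 2 * δHS ^ 2) *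
      (Real.log (2 / δ) + 2 * n * Real.log d) ≤ N) :
    ((d : ℝ) ^ n) ^ 2 * (2 * Real.exp (-(N * (|α| * δHS / (d : ℝ) ^ n) ^ 2 / 2))) ≤ δ := by
  have hd' : (0 : ℝ) < d := by exact_mod_cast hd
  have h1 : Real.log (2 / δ) + 2 * n * Real.log d ≤ N * (|α| * δHS / (d : ℝ) ^ n) ^ 2 / 2 := by
    have hp : 0 < α ^ 2 * δHS ^ 2 := by positivity
    rw [div_mul_eq_mul_div, div_le_iff₀ hp] at hN
    rw [div_pow, mul_pow, sq_abs, ← pow_mul, mul_comm n 2, mul_div_assoc', div_div,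
      le_div_iff₀ (by positivity)]
    linarith
  -- The term 2n ln d is the price of the union over d^(2n) coordinates: the hypothesis reads N ε²/2
  -- ≥ ln(2 d^(2n)/δ).
  have h2 : Real.log (2 / δ) + 2 * n * Real.log d = Real.log (2 * ((d : ℝ) ^ n) ^ 2 / δ) := by
    rw [mul_div_right_comm, Real.log_mul (by positivity) (by positivity), Real.log_pow,
      Real.log_pow]
    push_cast
    ring
  rw [h2] at h1
  have h3 : Real.exp (-(N * (|α| * δHS / (d : ℝ) ^ n) ^ 2 / 2)) ≤
      (2 * ((d : ℝ) ^ n) ^ 2 / δ)⁻¹ := by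
    rw [Real.exp_neg]
    refine inv_anti₀ (by positivity) ?_
    rwa [Real.log_le_iff_le_exp (by positivity)] at h1
  calc ((d : ℝ) ^ n) ^ 2 * (2 * Real.exp (-(N * (|α| * δHS / (d : ℝ) ^ n) ^ 2 / 2)))
      ≤ ((d : ℝ) ^ n) ^ 2 * (2 * (2 * ((d : ℝ) ^ n) ^ 2 / δ)⁻¹) := by gcongr
    _ = δ := by field_simp

theorem sampleSize_pos {n d N : ℕ} (hd : 1 ≤ d) {α δ δHS : ℝ} (hα : α ≠ 0)
    (hδ : 0 < δ) (hδ1 : δ < 1) (hδHS : 0 < δHS)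
    (hN : 2 * (d : ℝ) ^ (2 * n) / (α ^ 2 * δHS ^ 2) *
      (Real.log (2 / δ) + 2 * n * Real.log d) ≤ N) : 0 < N := by
  have hd' : (1 : ℝ) ≤ d := by exact_mod_cast hd
  have h1 : 0 < Real.log (2 / δ) := Real.log_pos (by rw [lt_div_iff₀ hδ]; linarith)
  have h2 : 0 ≤ Real.log d := Real.log_nonneg hd'
  have h3 : (0 : ℝ) < N := lt_of_lt_of_le (by positivity) hN
  exact_mod_cast h3

/-- There are d^(2n) orthonormal coordinates, so a tolerance of |α| δHS / d^n in each adds up to α²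
δHS², and the factor α² is lost on inversion. -/
theorem dHS_depolInv_le_of_coordinates {n d : ℕ} (hd : 1 ≤ d) {α : ℝ} (hα : α ≠ 0) (β : ℝ)
    {δHS : ℝ} (hδHS : 0 < δHS) {X Y : LogOp n d} (hX : X.IsHermitian) (hY : Y.IsHermitian)
    (h : ∀ j k, |reAddIm (Y j k) - reAddIm (((α : ℂ) • X + (β : ℂ) • (1 : LogOp n d)) j k)| ≤
      |α| * δHS / (d : ℝ) ^ n) :
    dHS X (depolInv α β Y) ≤ δHS ^ 2 := by
  have hd' : (0 : ℝ) < d := by exact_mod_cast hd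
  have hT : (Y - ((α : ℂ) • X + (β : ℂ) • (1 : LogOp n d))).IsHermitian := by
    refine hY.sub (Matrix.IsHermitian.add ?_ ?_)
    · rw [Matrix.IsHermitian, Matrix.conjTranspose_smul, hX.eq]
      simp
    · rw [Matrix.IsHermitian, Matrix.conjTranspose_smul]
      simp
  rw [dHS_depolInv hα, trace_conjTranspose_mul_self_re_eq_sum_sq hT]
  calc (α ^ 2)⁻¹ * ∑ j, ∑ k,
        reAddIm ((Y - ((α : ℂ) • X + (β : ℂ) • (1 : LogOp n d))) j k) ^ 2
      ≤ (α ^ 2)⁻¹ * ∑ _j : LogIdx n d, ∑ _k : LogIdx n d, (|α| * δHS / (d : ℝ) ^ n) ^ 2 := by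
        refine mul_le_mul_of_nonneg_left (Finset.sum_le_sum fun j _ => Finset.sum_le_sum
          fun k _ => ?_) (by positivity)
        rw [← sq_abs, Matrix.sub_apply, map_sub]
        exact pow_le_pow_left₀ (abs_nonneg _) (h j k) 2
    _ = δHS ^ 2 := by
        simp only [Finset.sum_const, Finset.card_univ, Fintype.card_fun, Fintype.card_fin,
          nsmul_eq_mul, Nat.cast_pow, div_pow, mul_pow, sq_abs]
        field_simp

theorem isHermitian_decode_shadow {n d N : ℕ} {C : ScaledCode n d} {Z : Type*} [MeasurableSpace Z]
    {ν : Measure Z} {Pi : Z → ModeOp n} (hPi : IsPOVM ν Pi) (U : SymplAut C → ModeUnitary n)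
    {E : LogIdx n d → LogIdx n d → ModeOp n}
    (hE : ∀ ρ, IsDensityOp ρ → IsDensityMatrix (decode E ρ)) (s : Fin N → Gate C × Z) :
    (decode E (shadow Pi U s)).IsHermitian := by
  refine Matrix.IsHermitian.ext fun j k => ?_
  rw [decode_shadow_apply hPi, decode_shadow_apply hPi, star_mul', star_sum]
  congr 1
  · simp
  · exact Finset.sum_congr rfl fun i _ =>
      (hE _ ((hPi.density (s i).2).conj (gateUnitary U (s i).1))).1.1.apply j k

end GKP

/-! ### The sample complexity bound -/

theorem theorem2 {n d : ℕ} (hd : 1 ≤ d) (C : GKP.ScaledCode n d)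
    (U : GKP.SymplAut C → GKP.ModeUnitary n)
    (hU : ∀ S : GKP.SymplAut C, GKP.IsGaussianUnitary S.toEquiv (U S))
    (P : GKP.PhaseSpace n → GKP.LogUnitary n d) (hP : GKP.IsLogicalPauli C P)
    (V : GKP.SymplAut C → GKP.LogUnitary n d) (hV : GKP.IsLogicalClifford P V)
    (μ : PMF (GKP.Gate C)) (hμ : GKP.IsTwoDesign P V μ)
    (E : GKP.LogIdx n d → GKP.LogIdx n d → GKP.ModeOp n)
    (hE : GKP.IsDecoder C P U V μ.support E)
    {Z : Type*} [MeasurableSpace Z] (ν : Measure Z) [SigmaFinite ν]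
    (Pi : Z → GKP.ModeOp n) (hPi : GKP.IsPOVM ν Pi)
    (α β : ℝ) (hα : α ≠ 0)
    (hcomm : ∀ σ : GKP.ModeOp n, GKP.IsDensityOp σ →
      GKP.decode E (GKP.twirl μ U (GKP.povmChannel ν Pi) σ) =
        (α : ℂ) • GKP.decode E σ + (β : ℂ) • (1 : GKP.LogOp n d))
    (ρ : GKP.ModeOp n) (hρ : GKP.IsDensityOp ρ)
    {Ω : Type*} [MeasurableSpace Ω] (Pr : Measure Ω) [IsProbabilityMeasure Pr]
    (N : ℕ) (X : Fin N → Ω → GKP.Gate C × Z)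
    (hlaw : ∀ i, HasLaw (X i) (GKP.sampleLaw ν Pi μ U ρ) Pr)
    (hindep : iIndepFun X Pr)
    (δ δHS : ℝ) (hδ : 0 < δ) (hδHS : 0 < δHS)
    (hN : 2 * (d : ℝ) ^ (2 * n) / (α ^ 2 * δHS ^ 2) *
      (Real.log (2 / δ) + 2 * n * Real.log d) ≤ N) :
    ENNReal.ofReal (1 - δ) ≤
      Pr {ω | GKP.dHS (GKP.decode E ρ)
              (GKP.depolInv α β (GKP.decode E (GKP.shadow Pi U fun i => X i ω))) ≤ δHS ^ 2 ∧
            GKP.traceDist (GKP.decode E ρ)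
              (GKP.depolInv α β (GKP.decode E (GKP.shadow Pi U fun i => X i ω))) ≤
                (d : ℝ) ^ ((n : ℝ) / 2) * (δHS / 2)} := by
  -- For δ ≥ 1 the claim is empty; for δ < 1 the logarithm is positive and forces N > 0.
  rcases le_or_gt 1 δ with h1 | h1
  · rw [ENNReal.ofReal_of_nonpos (by linarith)]
    exact zero_le
  have hN0 := GKP.sampleSize_pos hd hα hδ h1 hδHS hN
  -- The sample law is the law of the first sample, hence a probability measure; this supplies the
  -- finiteness used for integrability.
  have hprob : IsProbabilityMeasure (GKP.sampleLaw ν Pi μ U ρ) := by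
    rw [← (hlaw ⟨0, hN0⟩).map_eq]
    exact Measure.isProbabilityMeasure_map (hlaw ⟨0, hN0⟩).aemeasurable
  set A : GKP.Gate C × Z → GKP.LogOp n d := fun x =>
    GKP.decode E (GKP.conj (GKP.gateUnitary U x.1) (Pi x.2)) with hA
  set M : GKP.LogOp n d := (α : ℂ) • GKP.decode E ρ + (β : ℂ) • (1 : GKP.LogOp n d) with hM
  set ε : ℝ := |α| * δHS / (d : ℝ) ^ n with hε
  have hε0 : 0 ≤ ε := by positivity
  have hAm : ∀ j k, AEStronglyMeasurable (fun x => A x j k) (GKP.sampleLaw ν Pi μ U ρ) :=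
    fun j k => GKP.aestronglyMeasurable_decode_pointer hPi μ U E j k
  have hAd : ∀ x, GKP.IsDensityMatrix (A x) := fun x =>
    hE.map_state _ ((hPi.density x.2).conj _)
  have hcoord : ∀ j k, AEMeasurable (fun x => GKP.reAddIm (A x j k))
      (GKP.sampleLaw ν Pi μ U ρ) := fun j k =>
    (GKP.reAddIm.continuous.comp_aestronglyMeasurable (hAm j k)).aemeasurable
  have hint : ∀ j k, Integrable (fun x => A x j k) (GKP.sampleLaw ν Pi μ U ρ) := fun j k =>
    GKP.integrable_decode_pointer hPi μ U E j k
  have hmean : ∀ j k i, ∫ ω, GKP.reAddIm (A (X i ω) j k) ∂Pr = GKP.reAddIm (M j k) := by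
    intro j k i
    have e := (hlaw i).integral_comp (hcoord j k).aestronglyMeasurable
    refine Eq.trans e ?_
    rw [GKP.reAddIm.integral_comp_comm (hint j k), hM, ← hcomm ρ hρ,
      GKP.decode_twirl_apply hPi μ U hρ E j k]
  have htail : ∀ j k, Pr.real {ω | ε ≤ |(N : ℝ)⁻¹ * ∑ i, GKP.reAddIm (A (X i ω) j k)
      - GKP.reAddIm (M j k)|} ≤ 2 * Real.exp (-(N * ε ^ 2 / 2)) := by
    intro j k
    have hc : ∀ i, AEMeasurable (fun x => GKP.reAddIm (A x j k)) (Pr.map (X i)) := fun i => by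
      rw [(hlaw i).map_eq]
      exact hcoord j k
    refine GKP.measureReal_abs_mean_sub_ge_le hN0
      (hindep.comp₀ (fun _ x => GKP.reAddIm (A x j k)) (fun i => (hlaw i).aemeasurable) hc)
      (fun i => (hc i).comp_aemeasurable (hlaw i).aemeasurable)
      (fun i ω => GKP.abs_reAddIm_le_one (hAd _).1 (hAd _).2 j k) (hmean j k) hε0
  -- The bad event: some coordinate of the empirical mean is off by at least ε.
  set B : Set Ω := ⋃ p : GKP.LogIdx n d × GKP.LogIdx n d,
    {ω | ε ≤ |(N : ℝ)⁻¹ * ∑ i, GKP.reAddIm (A (X i ω) p.1 p.2) - GKP.reAddIm (M p.1 p.2)|} with hB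
  have hBle : Pr.real B ≤ δ := by
    refine (measureReal_iUnion_fintype_le _).trans ?_
    refine (Finset.sum_le_sum fun p _ => htail p.1 p.2).trans ?_
    refine le_trans (le_of_eq ?_) (GKP.unionBound_le_of_sampleSize hd hα hδ hδHS hN)
    simp only [Finset.sum_const, Finset.card_univ, Fintype.card_prod, Fintype.card_fun,
      Fintype.card_fin, nsmul_eq_mul, Nat.cast_mul, Nat.cast_pow]
    ring
  have hgood : 1 - δ ≤ Pr.real Bᶜ := by
    -- Subadditivity replaces the complement formula, which would require B to be measurable; the
    -- samples are only almost everywhere measurable.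
    have h2 : (1 : ℝ) ≤ Pr.real B + Pr.real Bᶜ := by
      rw [← probReal_univ (μ := Pr), ← Set.union_compl_self B]
      exact measureReal_union_le _ _
    linarith
  refine (ENNReal.ofReal_le_ofReal hgood).trans ?_
  rw [ofReal_measureReal]
  refine measure_mono fun ω hω => ?_
  have hdHS : GKP.dHS (GKP.decode E ρ)
      (GKP.depolInv α β (GKP.decode E (GKP.shadow Pi U fun i => X i ω))) ≤ δHS ^ 2 := by
    refine GKP.dHS_depolInv_le_of_coordinates hd hα β hδHS (hE.map_state ρ hρ).1.1
      (GKP.isHermitian_decode_shadow hPi U hE.map_state _) fun j k => ?_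
    have h2 : ω ∉ {ω | ε ≤ |(N : ℝ)⁻¹ * ∑ i, GKP.reAddIm (A (X i ω) j k)
        - GKP.reAddIm (M j k)|} := fun h => hω (Set.mem_iUnion.2 ⟨(j, k), h⟩)
    have h3 : GKP.reAddIm (GKP.decode E (GKP.shadow Pi U fun i => X i ω) j k) =
        (N : ℝ)⁻¹ * ∑ i, GKP.reAddIm (A (X i ω) j k) := by
      rw [GKP.decode_shadow_apply hPi]
      have : ((N : ℂ)⁻¹) = (((N : ℝ)⁻¹ : ℝ) : ℂ) := by push_cast; rfl
      rw [this, ← Complex.real_smul, map_smul, map_sum, smul_eq_mul]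
    rw [h3]
    exact (not_le.1 h2).le
  exact ⟨hdHS, GKP.traceDist_le_of_dHS_le hδHS.le hdHS⟩
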